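/- Call a field $K$ \emph{large} if every smooth curve $X$ over $K$ that has a $K$-rational point has infinitely many $K$-rational points; here a smooth curve over $K$ is a separated $K$-scheme of finite type that is smooth of relative dimension $1$ over $K$, and a $K$-rational point of $X$ is a $K$-morphism $\operatorname{Spec} K\to X$. A (Krull) valuation $v$ on $K$, with values in an arbitrary ordered abelian group, is \emph{henselian} if its valuation ring satisfies Hensel's lemma: every simple root in the residue field of the reduction of a monic polynomial over the valuation ring lifts to a root of that polynomial in the valuation ring. \textbf{Proposition.} If a field $K$ admits a non-trivial henselian valuation, then $K$ is large. -/

import Mathlib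

open CategoryTheory AlgebraicGeometry

universe u v

/-- The `K`-rational points of a `K`-scheme `f : X ⟶ Spec K`: the `K`-morphisms `Spec K ⟶ X`,
that is, the sections of the structure morphism `f`. -/
def RationalPoint (K : Type u) [Field K] {X : Scheme.{u}} (f : X ⟶ Spec (CommRingCat.of K)) :
    Type u :=
  {p : Spec (CommRingCat.of K) ⟶ X // p ≫ f = 𝟙 _}

/-- `f : X ⟶ Spec K` is a smooth curve over `K`: a separated `K`-scheme of finite type which is
smooth of relative dimension one. (It may be disconnected; a connected one with a rational point
is automatically geometrically integral.) -/
structure IsSmoothCurve (K : Type u) [Field K] {X : Scheme.{u}}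
    (f : X ⟶ Spec (CommRingCat.of K)) : Prop where
  separated : IsSeparated f
  locallyOfFiniteType : LocallyOfFiniteType f
  quasiCompact : QuasiCompact f
  smooth : SmoothOfRelativeDimension 1 f

/-- A field `K` is large if, for every smooth curve over `K`, the set of rational points is
infinite as soon as it is non-empty. -/
def IsLargeField (K : Type u) [Field K] : Prop :=
  ∀ (X : Scheme.{u}) (f : X ⟶ Spec (CommRingCat.of K)), IsSmoothCurve K f →
    Nonempty (RationalPoint K f) → Infinite (RationalPoint K f)

/-- A (Krull) valuation `v` on a field is henselian if its valuation ring satisfies Hensel's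
lemma: simple roots of monic polynomials in the residue field lift to roots in the valuation
ring. -/
def IsHenselianValuation {K : Type u} [Field K] {Γ₀ : Type v}
    [LinearOrderedCommGroupWithZero Γ₀] (v : Valuation K Γ₀) : Prop :=
  HenselianLocalRing v.valuationSubring

/-! Near a rational point, a smooth curve has an affine chart étale over the line, and after
shrinking to a principal open the chart is standard étale: a simple root of a polynomial whose
coefficients are functions of the coordinate `t`. By Hensel's lemma such a root survives small
changes of `t` in the valuation topology (`Polynomial.eventually_exists_root`), so all `t` near the
original value lift to rational points. A nontrivial valuation has no isolated points, so there are
infinitely many such `t`, and distinct `t` give distinct points. -/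

open Polynomial in
/-- Hensel's lemma in scaled form: if `v (q₁ ^ i)` dominates `v (qᵢ * q₀ ^ (i - 1))` for `i ≥ 2`,
then the possibly non-monic polynomial `q = ∑ qᵢ Xⁱ` has a root of size at most `v (q₀ / q₁)`. -/
theorem Polynomial.exists_root_of_henselian {K : Type u} [Field K] {Γ₀ : Type v}
    [LinearOrderedCommGroupWithZero Γ₀] (v : Valuation K Γ₀)
    [HenselianLocalRing v.valuationSubring] (q : K[X]) (h1 : q.coeff 1 ≠ 0)
    (hq : ∀ i ≤ q.natDegree, 2 ≤ i → v (q.coeff i * q.coeff 0 ^ (i - 1)) < v (q.coeff 1 ^ i)) :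
    ∃ y, q.IsRoot y ∧ v y ≤ v (q.coeff 0 / q.coeff 1) := by
  obtain h0 | h0 := eq_or_ne (q.coeff 0) 0
  · exact ⟨0, by rwa [IsRoot, ← coeff_zero_eq_eval_zero], by simp⟩
  -- Substituting `q₀ / (q₁ w)` in `q` gives `q₀ (1 + w⁻¹ + ∑ cᵢ w⁻ⁱ)`, the sum over `i ≥ 2`.
  -- Multiplying by a power of `w` makes the bracket monic and integral, even if `q` is neither.
  set c : ℕ → K := fun i ↦ q.coeff i * q.coeff 0 ^ (i - 1) / q.coeff 1 ^ i with hc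
  have hcv (i : ℕ) (hi : 2 ≤ i) : v (c i) < 1 := by
    rcases le_or_gt i q.natDegree with h | h
    · rw [hc, map_div₀, div_lt_one₀ (by simp [zero_lt_iff, h1])]
      exact hq i h hi
    · simp [hc, coeff_eq_zero_of_natDegree_lt h]
  let O := v.valuationSubring
  let c' (i : ℕ) : O := ⟨c (i + 2), (hcv (i + 2) (by lia)).le⟩
  have hmem (x : O) : x ∈ IsLocalRing.maximalIdeal O ↔ v x < 1 := v.mem_maximalIdeal_iff
  have hc' (i : ℕ) : c' i ∈ IsLocalRing.maximalIdeal O := (hmem _).2 (hcv (i + 2) (by lia))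
  obtain ⟨m, hm⟩ : ∃ m, q.natDegree ≤ m + 2 := ⟨q.natDegree, by lia⟩
  let r : O[X] := ∑ i ∈ Finset.range (m + 1), C (c' i) * X ^ (m - i)
  have hr : r.natDegree ≤ m := natDegree_sum_le_of_forall_le _ _ fun i _ ↦
    (natDegree_C_mul_X_pow_le _ _).trans (by lia)
  let h : O[X] := X ^ (m + 2) + (X ^ (m + 1) + r)
  have hh : h.Monic := by
    refine monic_X_pow_add ?_
    refine (degree_add_le _ _).trans_lt (max_lt ?_ ?_)
    · rw [degree_X_pow]; exact_mod_cast (by lia)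
    · exact (degree_le_of_natDegree_le hr).trans_lt (by exact_mod_cast (by lia))
  have hr0 (x : O) : r.eval x ∈ IsLocalRing.maximalIdeal O := by
    simp only [r, eval_finsetSum, eval_mul, eval_C]
    exact Ideal.sum_mem _ fun i _ ↦ Ideal.mul_mem_right _ _ (hc' i)
  have hr1 (x : O) : r.derivative.eval x ∈ IsLocalRing.maximalIdeal O := by
    simp only [r, derivative_sum, derivative_C_mul, eval_finsetSum, eval_mul, eval_C]
    exact Ideal.sum_mem _ fun i _ ↦ Ideal.mul_mem_right _ _ (hc' i)
  -- Since the `cᵢ` lie in the maximal ideal, `h` reduces to `X ^ (m + 1) * (X + 1)`, which has the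
  -- simple root `-1`.
  obtain ⟨w, hw, hw1⟩ := HenselianLocalRing.is_henselian h hh (-1)
    (by
      have : h.eval (-1) = r.eval (-1) := by simp [h, pow_succ]
      rw [this]; exact hr0 _)
    (by
      have : h.derivative.eval (-1) = (-1) ^ (m + 1) + r.derivative.eval (-1) := by
        simp [h, pow_succ]; ring
      rw [this]
      by_contra hu
      have := (IsLocalRing.mem_maximalIdeal _).2 (mem_nonunits_iff.2 hu)
      rw [Ideal.add_mem_iff_left _ (hr1 _), IsLocalRing.mem_maximalIdeal, mem_nonunits_iff] at this
      exact this (isUnit_one.neg.pow _))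
  have hwv : v (w : K) = 1 := by
    have hlt : v ((w : K) + 1) < 1 := by simpa using (hmem _).1 hw1
    have := v.map_sub_eq_of_lt_right (x := (w : K) + 1) (y := 1) (by simpa using hlt)
    simpa using this
  have hw0 : (w : K) ≠ 0 := fun h ↦ by simp [h] at hwv
  have hwK : (w : K) ^ (m + 2) + (w ^ (m + 1) +
      ∑ i ∈ Finset.range (m + 1), c (i + 2) * (w : K) ^ (m - i)) = 0 := by
    have := congrArg (Subtype.val) hw.eq_zero
    simpa [h, r, eval_finsetSum, c'] using this
  refine ⟨q.coeff 0 / q.coeff 1 * (w : K)⁻¹, ?_, by simp [hwv]⟩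
  rw [IsRoot, eval_eq_sum_range' (n := m + 3) (by lia), Finset.sum_range_succ', Finset.sum_range_succ']
  have key : ∀ i ∈ Finset.range (m + 1),
      q.coeff (i + 1 + 1) * (q.coeff 0 / q.coeff 1 * (w : K)⁻¹) ^ (i + 1 + 1) =
      q.coeff 0 * (w : K)⁻¹ ^ (m + 2) * (c (i + 2) * (w : K) ^ (m - i)) := by
    intro i hi
    obtain ⟨k, rfl⟩ := Nat.exists_eq_add_of_le (Nat.lt_succ_iff.1 (Finset.mem_range.1 hi))
    simp only [hc, Nat.add_sub_cancel_left, Nat.add_succ_sub_one, div_pow, mul_pow, inv_pow]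
    field_simp
    ring
  rw [Finset.sum_congr rfl key, ← Finset.mul_sum]
  rw [← add_assoc, add_comm, ← eq_neg_iff_add_eq_zero] at hwK
  rw [hwK]
  simp only [inv_pow, zero_add, pow_one, pow_zero, mul_one]
  field_simp
  ring

open Polynomial Topology Filter in
/-- Over a henselian valued field, a simple root of a polynomial persists, near its original
position, when the coefficients vary continuously. -/
theorem Polynomial.eventually_exists_root {K : Type u} [Field K] {Γ₀ : Type v}
    [LinearOrderedCommGroupWithZero Γ₀] [Valued K Γ₀]
    [HenselianLocalRing (Valued.v (R := K)).valuationSubring]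
    {T R : Type*} [TopologicalSpace T] [CommRing R] [Algebra K R] (φ : T → R →ₐ[K] K)
    (hφ : ∀ r, Continuous fun t ↦ φ t r) (f : R[X]) (t₀ : T) (y₀ : K)
    (h0 : f.eval₂ (φ t₀ : R →+* K) y₀ = 0) (h1 : f.derivative.eval₂ (φ t₀ : R →+* K) y₀ ≠ 0)
    {U : Set K} (hU : U ∈ 𝓝 y₀) :
    ∀ᶠ t in 𝓝 t₀, ∃ y ∈ U, f.eval₂ (φ t : R →+* K) y = 0 := by
  -- After moving `y₀` to the origin, the constant coefficient vanishes at `t₀` and the linear one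
  -- does not. The scaled Hensel inequalities therefore hold at `t₀` with left side zero, and
  -- persist nearby.
  let F : R[X] := taylor (algebraMap K R y₀) f
  have hF (t : T) (z : K) : (F.map (φ t : R →+* K)).eval z = f.eval₂ (φ t : R →+* K) (z + y₀) := by
    simp [F, taylor_apply, eval_map, eval₂_comp]
  have hF0 : φ t₀ (F.coeff 0) = 0 := by
    have := hF t₀ 0
    rwa [zero_add, h0, ← coeff_zero_eq_eval_zero, coeff_map] at this
  have hF1 : φ t₀ (F.coeff 1) ≠ 0 := by
    have h := eval₂_at_apply (p := f.derivative) (φ t₀ : R →+* K) (algebraMap K R y₀)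
    rw [RingHom.coe_coe, AlgHom.commutes, Algebra.algebraMap_self, RingHom.id_apply] at h
    rwa [taylor_coeff_one, ← h]
  obtain ⟨γ, hγ⟩ := Valued.mem_nhds.1 hU
  have hlim {a b : T → K} (ha : Continuous a) (hb : Continuous b) (h : a t₀ = 0) (h' : b t₀ ≠ 0) :
      ∀ᶠ t in 𝓝 t₀, Valued.v (a t) < Valued.v (b t) := by
    have h1 : Tendsto (a / b) (𝓝 t₀) (𝓝 0) := by
      simpa [h] using ha.continuousAt.tendsto.div hb.continuousAt.tendsto h'
    filter_upwards [h1 (Valued.mem_nhds_zero.2 ⟨1, subset_rfl⟩),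
      hb.continuousAt.eventually_ne h'] with t ht ht'
    have : Valued.v (a t / b t) < 1 := Valued.v.restrict_lt_one_iff.1 ht
    rwa [map_div₀, div_lt_one₀ (by simpa [zero_lt_iff] using ht')] at this
  have hsmall : ∀ᶠ t in 𝓝 t₀, φ t (F.coeff 0) / φ t (F.coeff 1) ∈
      {x | Valued.v.restrict x < (γ : MonoidWithZeroHom.ValueGroup₀ _)} := by
    have : Tendsto ((fun t ↦ φ t (F.coeff 0)) / fun t ↦ φ t (F.coeff 1)) (𝓝 t₀) (𝓝 0) := by
      simpa [hF0] using (hφ (F.coeff 0)).continuousAt.tendsto.div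
        (hφ (F.coeff 1)).continuousAt.tendsto hF1
    exact this (Valued.mem_nhds_zero.2 ⟨γ, subset_rfl⟩)
  have hcoeff : ∀ᶠ t in 𝓝 t₀, ∀ i ∈ Finset.Icc 2 F.natDegree,
      Valued.v (φ t (F.coeff i) * φ t (F.coeff 0) ^ (i - 1)) <
        Valued.v (φ t (F.coeff 1) ^ i) := by
    rw [Filter.eventually_all_finset]
    intro i hi
    have hi := (Finset.mem_Icc.1 hi).1
    refine hlim ((hφ _).mul ((hφ _).pow _)) ((hφ _).pow _) ?_ (pow_ne_zero _ hF1)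
    rw [hF0, zero_pow (by lia), mul_zero]
  filter_upwards [hsmall, hcoeff, (hφ (F.coeff 1)).continuousAt.eventually_ne hF1] with t h1 h2 h3
  obtain ⟨z, hz, hzv⟩ := exists_root_of_henselian Valued.v (F.map (φ t : R →+* K))
    (by simpa using h3) fun i hi hi' ↦ by
      simpa using h2 i (Finset.mem_Icc.2 ⟨hi', hi.trans natDegree_map_le⟩)
  refine ⟨z + y₀, hγ ?_, by rw [← hF]; exact hz⟩
  simp only [coeff_map, RingHom.coe_coe] at hzv
  simpa using (Valued.v.restrict_le_iff.2 hzv).trans_lt h1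

-- Multiplying an element of value `γ` by a nonzero `a` with `v a < 1` gives a nonzero displacement
-- inside the ball of radius `γ`.
open Topology Filter in
theorem Valued.nhdsNE_neBot {K : Type u} [Field K] {Γ₀ : Type v}
    [LinearOrderedCommGroupWithZero Γ₀] [Valued K Γ₀]
    [(Valued.v (R := K)).IsNontrivial] (x : K) : (𝓝[≠] x).NeBot := by
  rw [← mem_closure_iff_nhdsWithin_neBot, mem_closure_iff_nhds]
  intro U hU
  obtain ⟨γ, hγ⟩ := Valued.mem_nhds.1 hU
  obtain ⟨c, hc⟩ := MonoidWithZeroHom.ValueGroup₀.restrict₀_surjective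
    (.ofClass (Valued.v (R := K))) γ.1
  obtain ⟨a, ha, ha1⟩ := Valuation.IsNontrivial.exists_lt_one (v := Valued.v (R := K))
  have hc' : Valued.v.restrict c = γ.1 := hc
  have hc0 : c ≠ 0 := by
    rintro rfl
    exact γ.ne_zero (by rw [← hc', map_zero])
  refine ⟨x + c * a, hγ ?_, by simp [hc0, ha]⟩
  simp only [add_sub_cancel_left, Set.mem_ofPred_eq, ← hc', Valuation.restrict_lt_iff, map_mul]
  exact mul_lt_of_lt_one_right (by simpa [zero_lt_iff] using hc0) ha1

open Polynomial Topology Filter in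
/-- Over a henselian valued field, a rational point of a standard étale algebra deforms along any
continuous deformation of its image in the base. -/
theorem Algebra.IsStandardEtale.eventually_exists_extension {K : Type u} [Field K] {Γ₀ : Type v}
    [LinearOrderedCommGroupWithZero Γ₀] [Valued K Γ₀]
    [HenselianLocalRing (Valued.v (R := K)).valuationSubring]
    {T R S : Type*} [TopologicalSpace T] [CommRing R] [Algebra K R] [CommRing S] [Algebra R S]
    [Algebra.IsStandardEtale R S] (φ : T → R →ₐ[K] K)
    (hφ : ∀ r, Continuous fun t ↦ φ t r) (t₀ : T) (ψ₀ : S →+* K)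
    (hψ₀ : ψ₀.comp (algebraMap R S) = φ t₀) :
    ∀ᶠ t in 𝓝 t₀, ∃ ψ : S →+* K, ψ.comp (algebraMap R S) = φ t := by
  obtain ⟨P⟩ := IsStandardEtale.nonempty_standardEtalePresentation (R := R) (S := S)
  have heval (p : R[X]) : p.eval₂ (φ t₀ : R →+* K) (ψ₀ P.x) = ψ₀ (aeval P.x p) := by
    rw [aeval_def, hom_eval₂, hψ₀]
  have h0 : P.f.eval₂ (φ t₀ : R →+* K) (ψ₀ P.x) = 0 := by
    rw [heval, P.hasMap.1, map_zero]
  have h1 : P.f.derivative.eval₂ (φ t₀ : R →+* K) (ψ₀ P.x) ≠ 0 := by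
    rw [heval]
    exact (P.hasMap.isUnit_derivative_f.map ψ₀).ne_zero
  have hg : P.g.eval₂ (φ t₀ : R →+* K) (ψ₀ P.x) ≠ 0 := by
    rw [heval]
    exact (P.hasMap.2.map ψ₀).ne_zero
  have hcont : Continuous fun z : T × K ↦ P.g.eval₂ (φ z.1 : R →+* K) z.2 := by
    simp only [eval₂_eq_sum_range]
    exact continuous_finsetSum _ fun i _ ↦
      ((hφ _).comp continuous_fst).mul (continuous_snd.pow i)
  have hne : ∀ᶠ z : T × K in 𝓝 (t₀, ψ₀ P.x), P.g.eval₂ (φ z.1 : R →+* K) z.2 ≠ 0 :=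
    hcont.continuousAt.eventually_ne hg
  rw [nhds_prod_eq, eventually_prod_iff] at hne
  obtain ⟨pa, hpa, pb, hpb, hab⟩ := hne
  -- The root is kept close enough to the old one that `g` stays nonzero there, hence invertible.
  filter_upwards [hpa, eventually_exists_root φ hφ P.f t₀ (ψ₀ P.x) h0 h1 hpb] with t ht ⟨y, hy, hy0⟩
  algebraize [(φ t : R →+* K)]
  have hmap : P.HasMap y := ⟨hy0, (isUnit_iff_ne_zero.2 (hab ht hy))⟩
  exact ⟨((P.P.lift y hmap).comp P.equivRing.toAlgHom).toRingHom,
    ((P.P.lift y hmap).comp P.equivRing.toAlgHom).comp_algebraMap⟩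

open Topology Filter in
/-- A standard smooth algebra of relative dimension one over a field with a nontrivial henselian
valuation has infinitely many rational points as soon as it has one. -/
theorem Algebra.IsStandardSmoothOfRelativeDimension.infinite_algHom {K : Type u} [Field K]
    {Γ₀ : Type v} [LinearOrderedCommGroupWithZero Γ₀] (v : Valuation K Γ₀) [v.IsNontrivial]
    [HenselianLocalRing v.valuationSubring] (A : Type*) [CommRing A] [Algebra K A]
    [Algebra.IsStandardSmoothOfRelativeDimension 1 K A] [Nonempty (A →ₐ[K] K)] :
    Infinite (A →ₐ[K] K) := by
  let : Valued K Γ₀ := Valued.mk' v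
  have : (Valued.v (R := K)).IsNontrivial := ‹v.IsNontrivial›
  have : HenselianLocalRing (Valued.v (R := K)).valuationSubring := ‹_›
  obtain ⟨ψ₀⟩ := ‹Nonempty (A →ₐ[K] K)›
  obtain ⟨χ, hχ⟩ :=
    Algebra.IsStandardSmoothOfRelativeDimension.exists_etale_mvPolynomial 1 K A
  algebraize [χ.toRingHom]
  have : IsScalarTower K (MvPolynomial (Fin 1) K) A := .of_algebraMap_eq' χ.comp_algebraMap.symm
  have : Algebra.Etale (MvPolynomial (Fin 1) K) A := hχ
  have : (RingHom.ker (ψ₀ : A →+* K)).IsPrime := RingHom.ker_isPrime _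
  obtain ⟨f, hf, hstd⟩ := Algebra.IsEtaleAt.exists_isStandardEtale
    (R := MvPolynomial (Fin 1) K) (RingHom.ker (ψ₀ : A →+* K))
  let ψ₁ : Localization.Away f →+* K :=
    IsLocalization.Away.lift f (g := (ψ₀ : A →+* K)) (isUnit_iff_ne_zero.2 hf)
  let φ (t : K) : MvPolynomial (Fin 1) K →ₐ[K] K := MvPolynomial.aeval fun _ ↦ t
  have hφ (r : MvPolynomial (Fin 1) K) : Continuous fun t ↦ φ t r := by
    simp only [φ, MvPolynomial.aeval_eq_eval]
    exact (MvPolynomial.continuous_eval r).comp (continuous_pi fun _ ↦ continuous_id)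
  let t₀ : K := ψ₀ (χ (.X 0))
  have hψ₁ : ψ₁.comp (algebraMap (MvPolynomial (Fin 1) K) (Localization.Away f)) = φ t₀ := by
    have h : ψ₀.comp χ = φ t₀ := by
      ext i
      simp [φ, t₀, Subsingleton.elim i 0]
    rw [← h, IsScalarTower.algebraMap_eq _ A, ← RingHom.comp_assoc]
    congr 1
    exact IsLocalization.Away.lift_comp f _
  have hev : {t | ∃ ψ : A →ₐ[K] K, ψ.comp χ = φ t} ∈ 𝓝 t₀ := by
    filter_upwards [IsStandardEtale.eventually_exists_extension φ hφ t₀ ψ₁ hψ₁] with t ⟨ψ, hψ⟩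
    rw [IsScalarTower.algebraMap_eq _ A, ← RingHom.comp_assoc] at hψ
    have hψ' (r : MvPolynomial (Fin 1) K) : ψ (algebraMap A _ (χ r)) = φ t r := congr($hψ r)
    refine ⟨⟨ψ.comp (algebraMap A _), fun r ↦ ?_⟩, AlgHom.ext hψ'⟩
    simpa using hψ' (algebraMap K _ r)
  have := Valued.nhdsNE_neBot t₀
  have hinf := infinite_of_mem_nhds t₀ hev
  -- The parameter `t` is recovered from the point as the value of the coordinate `χ (X 0)`, so the
  -- choice is injective.
  choose! g hg using fun t (ht : t ∈ {t | ∃ ψ : A →ₐ[K] K, ψ.comp χ = φ t}) ↦ ht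
  refine @Infinite.of_injective _ _ hinf.to_subtype (fun t ↦ g t.1) fun s t hst ↦ Subtype.ext ?_
  have hs := congr($(hg s.1 s.2) (.X 0))
  have ht := congr($(hg t.1 t.2) (.X 0))
  simp only [φ, MvPolynomial.aeval_X] at hs ht
  rw [← hs, ← ht]
  exact congr($hst (χ (.X 0)))

/-- The composite of a ring homomorphism `Γ(V) ⟶ K` over `K` with the immersion of the affine
open `V`, as a rational point. -/
noncomputable def RationalPoint.ofAffineOpen {K : Type u} [Field K] {X : Scheme.{u}}
    (f : X ⟶ Spec (CommRingCat.of K)) {V : X.Opens} (hV : IsAffineOpen V)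
    (g : CommRingCat.of K ⟶ Γ(X, V)) (hg : hV.fromSpec ≫ f = Spec.map g) (ψ : Γ(X, V) ⟶ .of K)
    (hψ : g ≫ ψ = 𝟙 _) : RationalPoint K f :=
  ⟨Spec.map ψ ≫ hV.fromSpec, by rw [Category.assoc, hg, ← Spec.map_comp, hψ, Spec.map_id]⟩

/-- As `Spec K` has a single point, the base open of a smooth chart is everything, and a rational
point meeting the chart factors through it. -/
theorem RationalPoint.exists_affineOpen {K : Type u} [Field K] {X : Scheme.{u}}
    (f : X ⟶ Spec (CommRingCat.of K)) [SmoothOfRelativeDimension 1 f] (p : RationalPoint K f) :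
    ∃ (V : X.Opens) (hV : IsAffineOpen V) (g : CommRingCat.of K ⟶ Γ(X, V))
      (_ : g.hom.IsStandardSmoothOfRelativeDimension 1) (_ : hV.fromSpec ≫ f = Spec.map g)
      (ψ : Γ(X, V) ⟶ .of K), g ≫ ψ = 𝟙 _ := by
  obtain ⟨p, hp⟩ := p
  obtain ⟨U, hU, V, hV, hx, e, h⟩ :=
    SmoothOfRelativeDimension.exists_isStandardSmoothOfRelativeDimension (n := 1) (f := f)
      (p (default : PrimeSpectrum K))
  obtain rfl : U = ⊤ := by
    refine top_le_iff.1 fun y _ ↦ ?_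
    rw [Subsingleton.elim (α := PrimeSpectrum K) y (f (p (default : PrimeSpectrum K)))]
    exact e hx
  have hpV : Set.range p ⊆ Set.range hV.fromSpec := by
    rw [hV.range_fromSpec]
    rintro _ ⟨y, rfl⟩
    rwa [Subsingleton.elim (α := PrimeSpectrum K) y default]
  let g : CommRingCat.of K ⟶ Γ(X, V) := (Scheme.ΓSpecIso _).inv ≫ f.appLE ⊤ V e
  have hg : hV.fromSpec ≫ f = Spec.map g := by
    rw [← hU.SpecMap_appLE_fromSpec f hV e, IsAffineOpen.fromSpec_top, Spec.map_comp,
      Scheme.isoSpec_Spec_inv]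
  refine ⟨V, hV, g, ?_, hg, Spec.preimage (IsOpenImmersion.lift hV.fromSpec p hpV), ?_⟩
  · exact (h.comp (RingHom.IsStandardSmoothOfRelativeDimension.equiv
      (Scheme.ΓSpecIso (CommRingCat.of K)).symm.commRingCatIsoToRingEquiv))
  · apply Spec.map_injective
    rw [Spec.map_comp, Spec.map_preimage, ← hg, IsOpenImmersion.lift_fac_assoc, hp, Spec.map_id]

theorem proposition1p13 {K : Type u} [Field K] {Γ₀ : Type v}
    [LinearOrderedCommGroupWithZero Γ₀] (v : Valuation K Γ₀)
    (hnontriv : v.IsNontrivial) (hhens : IsHenselianValuation v) :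
    IsLargeField K := by
  rintro X f hf ⟨p⟩
  have := hf.smooth
  have : HenselianLocalRing v.valuationSubring := hhens
  obtain ⟨V, hV, g, hgs, hg, ψ, hψ⟩ := p.exists_affineOpen
  algebraize [g.hom]
  have : Nonempty (Γ(X, V) →ₐ[K] K) := ⟨⟨ψ.hom, fun r ↦ congr($hψ r)⟩⟩
  have := Algebra.IsStandardSmoothOfRelativeDimension.infinite_algHom v Γ(X, V)
  refine Infinite.of_injective (fun χ : Γ(X, V) →ₐ[K] K ↦ RationalPoint.ofAffineOpen f hV g hg
    (CommRingCat.ofHom χ) (by ext r; exact χ.commutes r)) fun χ χ' h ↦ ?_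
  have h := Spec.map_injective ((cancel_mono hV.fromSpec).1 (congrArg Subtype.val h))
  ext r
  exact congr($h r)
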